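/- Let $n\ge 1$, $h<0$, $P=\{z\in\mathbb R^{n+1}: z_{n+1}=h\}$ with $n$-dimensional Lebesgue measure $\mu$, and let $\varGamma\subset S^n$ be a Borel set, $\sigma$ being the surface measure of $S^n$. For $z\in P$ and $d\ge 0$ let $E_z(d)$ be the ellipsoid of revolution with foci $0$ and $z$ and polar radius $$\rho_{z,d}(x)=\frac{d}{1-\varepsilon\,\hat z\cdot x},\qquad \hat z=\frac{z}{|z|},\quad \varepsilon=\sqrt{1+\frac{d^2}{|z|^2}}-\frac{d}{|z|}.$$ For $\rho:\varGamma\to(0,\infty)$ and $R=\{x\rho(x):x\in\varGamma\}$, the ellipsoid $E_z(d)$ supports $R$ at $m\in\varGamma$ if $\rho(m)=\rho_{z,d}(m)$ and $\rho\le\rho_{z,d}$ on $\varGamma$. The surface $R$ is a convex reflector with respect to $\Omega\subset P$ if at every $m\in\varGamma$ it has a supporting ellipsoid $E_z(d)$ with $z\in\Omega$. The reflecting map $T_R$ assigns to $x\in\varGamma$ the set of all such $z\in\Omega$ at $x$. For $w\subset\Omega$ let $V_R(w)$ be the set of $x\in\varGamma$ at which some $E_z(d)$ with $z\in w$ supports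 $R$, and for Borel sets $w\subset\Omega$ put $$\mu_R(w)=\int_{V_R(w)}I\,d\sigma .$$ Let $\Omega$ and $\Omega_k$ ($k\in\mathbb N$) be bounded smooth domains in $P$. Let $I\in L^1(\varGamma)$ with $I\ge 0$, and let $\pi$ be integrable and non-negative (almost everywhere) on $\Omega$ and on every $\Omega_k$, with $$\int_\varGamma I\,d\sigma=\int_\Omega\pi\,d\mu .$$ Let $\mu_s=I\,\sigma$ on $\varGamma$, and let $\mu_t=\pi\mathbf 1_\Omega\,\mu$ and $\mu_t^k=\pi\mathbf 1_{\Omega_k}\,\mu$, as measures on $P$. Let $R$ and $R_k$ be corresponding reflectors, that is, weak solutions of the reflector problem: $R$ is a convex reflector with respect to $\Omega$ with $\mu_R(w)=\mu_t(w)$ for every Borel set $w\subset\Omega$, and $R_k$ is a convex reflector with respect to $\Omega_k$ with $\mu_{R_k}(w)=\mu_t^k(w)$ for every Borel set $w\subset\Omega_k$. Then the geometric optics approximation measures $\mu_R$ and $\mu_{R_k}$, extended by zero to $P$ (that is, $w\mapsto\mu_R(w\cap\Omega)$ and $w\mapsto\mu_{R_k}(w\cap\Omega_k)$), are finite Borel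 measures. They are the push-forwards of $\mu_s$ under $T_R$ and $T_{R_k}$: every single-valued selection of $T_R$ on $\varGamma$ is $\mu_s$-measurable and pushes $\mu_s$ forward to $\mu_R$, and likewise for each $R_k$. Moreover, the measures $\mu_{R_k}$ are stable under perturbation of the target domain: 1. if $\mu_t^k\to\mu_t$ weakly as $k\to\infty$, then $\mu_{R_k}\to\mu_R$ weakly; 2. for each Borel set $w\subset P$, if $\mu_t^k(w)\to\mu_t(w)$, then $\mu_{R_k}(w)\to\mu_R(w)$; in particular setwise convergence of $\mu_t^k$ to $\mu_t$ implies setwise convergence of $\mu_{R_k}$ to $\mu_R$. -/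

import Mathlib

open MeasureTheory Filter Topology
open scoped ContDiff

noncomputable section

/-- The unit sphere `Sⁿ` of `ℝⁿ⁺¹` centred at the origin, the set of directions of rays. -/
abbrev Directions (n : ℕ) : Type :=
  Metric.sphere (0 : EuclideanSpace ℝ (Fin (n + 1))) 1

/-- The standard surface measure `σ` on `Sⁿ`. -/
abbrev surfaceMeasure (n : ℕ) : Measure (Directions n) :=
  (volume : Measure (EuclideanSpace ℝ (Fin (n + 1)))).toSphere

/-- The point `(y, h)` of the hyperplane `P = {z : z_{n+1} = h}` of `ℝⁿ⁺¹`. The map `y ↦ (y, h)` is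
an isometry of `ℝⁿ` onto `P`; subsets of `P` and Lebesgue measure on `P` are written in the
coordinate `y`. -/
def planePoint {n : ℕ} (h : ℝ) (y : EuclideanSpace ℝ (Fin n)) : EuclideanSpace ℝ (Fin (n + 1)) :=
  WithLp.toLp 2 (Fin.snoc (α := fun _ => ℝ) (fun i => y i) h)

/-- Bounded smooth domain: non-empty, connected, open, bounded, and near each boundary point a
strict sublevel set of a smooth function whose differential does not vanish at that point. -/
structure IsBoundedSmoothDomain {n : ℕ} (Ω : Set (EuclideanSpace ℝ (Fin n))) : Prop where
  isOpen : IsOpen Ω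
  isConnected : IsConnected Ω
  isBounded : Bornology.IsBounded Ω
  smooth_boundary : ∀ p ∈ frontier Ω, ∃ U ∈ 𝓝 p, ∃ f : EuclideanSpace ℝ (Fin n) → ℝ,
    ContDiff ℝ ∞ f ∧ fderiv ℝ f p ≠ 0 ∧ Ω ∩ U = {y | f y < 0} ∩ U

/-- Eccentricity of the ellipsoid of revolution with foci `0` and `z` and focal parameter `d`. -/
def eccentricity {n : ℕ} (z : EuclideanSpace ℝ (Fin (n + 1))) (d : ℝ) : ℝ :=
  Real.sqrt (1 + d ^ 2 / ‖z‖ ^ 2) - d / ‖z‖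

/-- Polar radius of the ellipsoid of revolution `E_z(d)` with foci `0` and `z` and focal
parameter `d`. -/
def ellipsoidRadius {n : ℕ} (z : EuclideanSpace ℝ (Fin (n + 1))) (d : ℝ) (x : Directions n) : ℝ :=
  d / (1 - eccentricity z d * inner ℝ (‖z‖⁻¹ • z) (x : EuclideanSpace ℝ (Fin (n + 1))))

/-- The ellipsoid `E_z(d)` supports the surface `{x ρ(x) : x ∈ Γ}` at the direction `m`. -/
def IsSupportingEllipsoid {n : ℕ} (Γ : Set (Directions n)) (ρ : Directions n → ℝ)
    (z : EuclideanSpace ℝ (Fin (n + 1))) (d : ℝ) (m : Directions n) : Prop :=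
  0 ≤ d ∧ m ∈ Γ ∧ ρ m = ellipsoidRadius z d m ∧ ∀ x ∈ Γ, ρ x ≤ ellipsoidRadius z d x

/-- `{x ρ(x) : x ∈ Γ}` is a convex reflecting surface with respect to the target domain `Ω` in the
plane at height `h`: the polar radius is positive and there is, at every direction of `Γ`, a
supporting ellipsoid with its second focus in `Ω`. -/
def IsConvexReflector {n : ℕ} (h : ℝ) (Γ : Set (Directions n)) (Ω : Set (EuclideanSpace ℝ (Fin n)))
    (ρ : Directions n → ℝ) : Prop :=
  (∀ x ∈ Γ, 0 < ρ x) ∧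
    ∀ m ∈ Γ, ∃ y ∈ Ω, ∃ d : ℝ, IsSupportingEllipsoid Γ ρ (planePoint h y) d m

/-- The (set-valued) reflecting map `T`: the foci in `Ω` of the ellipsoids that support the surface
at the direction `x`. -/
def reflectingMap {n : ℕ} (h : ℝ) (Γ : Set (Directions n)) (Ω : Set (EuclideanSpace ℝ (Fin n)))
    (ρ : Directions n → ℝ) (x : Directions n) : Set (EuclideanSpace ℝ (Fin n)) :=
  {y | y ∈ Ω ∧ ∃ d : ℝ, IsSupportingEllipsoid Γ ρ (planePoint h y) d x}

/-- The visibility set `V(w)`: the directions at which the surface has a supporting ellipsoid with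
its second focus in `w`. -/
def visibilitySet {n : ℕ} (h : ℝ) (Γ : Set (Directions n)) (ρ : Directions n → ℝ)
    (w : Set (EuclideanSpace ℝ (Fin n))) : Set (Directions n) :=
  {x | ∃ y ∈ w, ∃ d : ℝ, IsSupportingEllipsoid Γ ρ (planePoint h y) d x}

/-- The source measure `μ_s = I dσ` on `Γ`. -/
def sourceMeasure {n : ℕ} (Γ : Set (Directions n)) (I : Directions n → ℝ) :
    Measure (Directions n) :=
  ((surfaceMeasure n).restrict Γ).withDensity (fun x => ENNReal.ofReal (I x))

/-- The target measure `π dμ` on `Ω` (extended by zero to the whole plane). -/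
def targetMeasure {n : ℕ} (Ω : Set (EuclideanSpace ℝ (Fin n))) (π : EuclideanSpace ℝ (Fin n) → ℝ)
    (hπ : IntegrableOn π Ω volume) : FiniteMeasure (EuclideanSpace ℝ (Fin n)) :=
  ⟨(volume.restrict Ω).withDensity (fun z => ENNReal.ofReal (π z)),
    isFiniteMeasure_withDensity_ofReal hπ.2⟩

/-- The set function `μ_R(w) = ∫_{V(w)} I dσ`: the energy delivered by the reflector to `w`. -/
def deliveredEnergy {n : ℕ} (h : ℝ) (Γ : Set (Directions n)) (I : Directions n → ℝ)
    (ρ : Directions n → ℝ) (w : Set (EuclideanSpace ℝ (Fin n))) : ENNReal :=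
  ∫⁻ x in visibilitySet h Γ ρ w, ENNReal.ofReal (I x) ∂(surfaceMeasure n)

/-- The convex reflecting surface with polar radius `ρ` is a weak solution of the reflector problem
with source density `I` on `Γ` and target measure `μt` on `Ω`: it is convex with respect to `Ω`,
and `μ_R(w) = μt(w)` for every Borel set `w ⊆ Ω`. -/
def IsWeakSolution {n : ℕ} (h : ℝ) (Γ : Set (Directions n)) (I : Directions n → ℝ)
    (Ω : Set (EuclideanSpace ℝ (Fin n))) (μt : FiniteMeasure (EuclideanSpace ℝ (Fin n)))
    (ρ : Directions n → ℝ) : Prop :=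
  IsConvexReflector h Γ Ω ρ ∧
    ∀ w : Set (EuclideanSpace ℝ (Fin n)), MeasurableSet w → w ⊆ Ω →
      deliveredEnergy h Γ I ρ w = (μt : Measure (EuclideanSpace ℝ (Fin n))) w

/-- The finite measure `ν` is the geometric optics approximation measure of the reflector `ρ`
(extended by zero outside `Ω`): its values are `ν(w) = μ_R(w ∩ Ω)` for all Borel sets `w`, and it is
the push-forward of the source measure under the reflecting map, whichever values are selected
where the latter is multi-valued. The first clause determines `ν`. -/
def IsGeometricOpticsMeasure {n : ℕ} (h : ℝ) (Γ : Set (Directions n)) (I : Directions n → ℝ)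
    (Ω : Set (EuclideanSpace ℝ (Fin n))) (ρ : Directions n → ℝ)
    (ν : FiniteMeasure (EuclideanSpace ℝ (Fin n))) : Prop :=
  (∀ w : Set (EuclideanSpace ℝ (Fin n)), MeasurableSet w →
      (ν : Measure (EuclideanSpace ℝ (Fin n))) w = deliveredEnergy h Γ I ρ (w ∩ Ω)) ∧
    ∀ T : Directions n → EuclideanSpace ℝ (Fin n),
      (∀ x ∈ Γ, T x ∈ reflectingMap h Γ Ω ρ x) →
        AEMeasurable T (sourceMeasure Γ I) ∧
          (sourceMeasure Γ I).map T = (ν : Measure (EuclideanSpace ℝ (Fin n)))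

end

/-! For a weak solution the delivered energy equals the target measure on Borel subsets of the
domain, and the target measure vanishes off the domain. So the optics measure is the target measure,
and both stability claims are tautological. The content is the push-forward claim. If `T` selects
from the reflecting map, then `T ⁻¹' w ∩ Γ` lies in the visibility set of `w ∩ Ω`, so its outer
source measure is at most `ν w`. This bound for `w` and `wᶜ`, with equal total masses, forces
Carathéodory measurability of the preimage and then equality of measures. No regularity of `ρ` and
no uniqueness of supporting ellipsoids is needed. -/

/-- A set whose outer measure and that of its complement add up to the total mass is measurable up
to a null set (Carathéodory). -/
theorem nullMeasurableSet_of_measure_add_compl_le {α : Type*} [MeasurableSpace α] {μ : Measure α}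
    [IsFiniteMeasure μ] {s : Set α} (hs : μ s + μ sᶜ ≤ μ Set.univ) : NullMeasurableSet s μ := by
  set A := toMeasurable μ s
  set B := toMeasurable μ sᶜ
  have hA : MeasurableSet A := measurableSet_toMeasurable μ s
  have hsA : s ⊆ A := subset_toMeasurable μ s
  have hsB : sᶜ ⊆ B := subset_toMeasurable μ sᶜ
  have hAB : A ∪ B = Set.univ :=
    Set.eq_univ_of_univ_subset ((Set.union_compl_self s).symm.subset.trans
      (Set.union_subset_union hsA hsB))
  have hsum : μ (A ∪ B) + μ (A ∩ B) = μ s + μ sᶜ := by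
    rw [measure_union_add_inter' hA, measure_toMeasurable, measure_toMeasurable]
  -- The hulls cover the space, so their overlap is exactly the excess over the total mass;
  -- finiteness permits cancellation.
  have hnull : μ (A ∩ B) = 0 := by
    rw [hAB] at hsum
    have : μ Set.univ + μ (A ∩ B) ≤ μ Set.univ + 0 := by rw [hsum, add_zero]; exact hs
    exact le_antisymm ((ENNReal.add_le_add_iff_left (measure_ne_top μ _)).1 this) zero_le
  refine ⟨A, hA, ?_⟩
  refine Filter.EventuallyLE.antisymm (Filter.Eventually.of_forall hsA) ?_
  exact ae_le_set.2 (measure_mono_null (t := A ∩ B) (fun x hx => ⟨hx.1, hsB hx.2⟩) hnull)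

/-- A map is a.e. measurable and pushes `μ` forward to `ν` as soon as `ν` has the mass of `μ` and
dominates the outer measure of the preimages of measurable sets. -/
theorem aemeasurable_and_map_eq_of_measure_preimage_le {α β : Type*} [MeasurableSpace α]
    [MeasurableSpace β] [MeasurableSpace.CountablyGenerated β] [Nonempty β]
    {μ : Measure α} {ν : Measure β} [IsFiniteMeasure μ] {T : α → β}
    (huniv : ν Set.univ = μ Set.univ)
    (hle : ∀ w, MeasurableSet w → μ (T ⁻¹' w) ≤ ν w) :
    AEMeasurable T μ ∧ μ.map T = ν := by
  have : IsFiniteMeasure ν := ⟨huniv ▸ measure_lt_top μ _⟩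
  have hT : NullMeasurable T μ := fun w hw => by
    refine nullMeasurableSet_of_measure_add_compl_le ?_
    rw [← Set.preimage_compl, ← huniv, ← measure_add_measure_compl hw]
    exact add_le_add (hle w hw) (hle wᶜ hw.compl)
  -- Countable generation of the target σ-algebra lets the null sets of the individual preimages be
  -- merged into one.
  have hT' : AEMeasurable T μ := hT.aemeasurable
  refine ⟨hT', Measure.eq_of_le_of_measure_univ_eq (Measure.le_iff.2 fun w hw => ?_) ?_⟩
  · rw [Measure.map_apply_of_aemeasurable hT' hw]
    exact hle w hw
  · rw [Measure.map_apply_of_aemeasurable hT' MeasurableSet.univ, Set.preimage_univ, huniv]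

theorem visibilitySet_subset {n : ℕ} (h : ℝ) (Γ : Set (Directions n)) (ρ : Directions n → ℝ)
    (w : Set (EuclideanSpace ℝ (Fin n))) : visibilitySet h Γ ρ w ⊆ Γ := by
  rintro x ⟨y, -, d, hd⟩
  exact hd.2.1

theorem IsConvexReflector.visibilitySet_eq {n : ℕ} {h : ℝ} {Γ : Set (Directions n)}
    {Ω : Set (EuclideanSpace ℝ (Fin n))} {ρ : Directions n → ℝ}
    (hρ : IsConvexReflector h Γ Ω ρ) : visibilitySet h Γ ρ Ω = Γ :=
  (visibilitySet_subset h Γ ρ Ω).antisymm hρ.2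

/-- `V` need not be measurable: `withDensity_apply'` covers arbitrary sets because the base measure
is s-finite. This matters because visibility sets are not known to be Borel. -/
theorem sourceMeasure_apply_of_subset {n : ℕ} {Γ V : Set (Directions n)} (I : Directions n → ℝ)
    (hV : V ⊆ Γ) :
    sourceMeasure Γ I V = ∫⁻ x in V, ENNReal.ofReal (I x) ∂(surfaceMeasure n) := by
  rw [sourceMeasure, withDensity_apply', Measure.restrict_restrict_of_subset hV]

theorem deliveredEnergy_eq {n : ℕ} (h : ℝ) (Γ : Set (Directions n)) (I : Directions n → ℝ)
    (ρ : Directions n → ℝ) (w : Set (EuclideanSpace ℝ (Fin n))) :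
    deliveredEnergy h Γ I ρ w = sourceMeasure Γ I (visibilitySet h Γ ρ w) :=
  (sourceMeasure_apply_of_subset I (visibilitySet_subset h Γ ρ w)).symm

theorem sourceMeasure_compl {n : ℕ} {Γ : Set (Directions n)} (hΓ : MeasurableSet Γ)
    (I : Directions n → ℝ) : sourceMeasure Γ I Γᶜ = 0 :=
  withDensity_absolutelyContinuous _ _ (by simp [Measure.restrict_apply hΓ.compl])

theorem targetMeasure_inter {n : ℕ} {Ω : Set (EuclideanSpace ℝ (Fin n))} (hΩ : MeasurableSet Ω)
    {π : EuclideanSpace ℝ (Fin n) → ℝ} (hπ : IntegrableOn π Ω volume)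
    (w : Set (EuclideanSpace ℝ (Fin n))) :
    (targetMeasure Ω π hπ : Measure (EuclideanSpace ℝ (Fin n))) (w ∩ Ω) =
      (targetMeasure Ω π hπ : Measure (EuclideanSpace ℝ (Fin n))) w := by
  refine measure_inter_conull ?_
  exact withDensity_absolutelyContinuous (volume.restrict Ω) _
    (by simp [Measure.restrict_apply hΩ.compl])

/-- The energy delivered by a weak solution is the target measure, which is the push-forward of the
source measure under every selection of the reflecting map. -/
theorem IsWeakSolution.isGeometricOpticsMeasure {n : ℕ} {h : ℝ} {Γ : Set (Directions n)}
    (hΓ : MeasurableSet Γ) {I : Directions n → ℝ} (hI : IntegrableOn I Γ (surfaceMeasure n))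
    {Ω : Set (EuclideanSpace ℝ (Fin n))} (hΩ : MeasurableSet Ω)
    {π : EuclideanSpace ℝ (Fin n) → ℝ} {hπ : IntegrableOn π Ω volume} {ρ : Directions n → ℝ}
    (hρ : IsWeakSolution h Γ I Ω (targetMeasure Ω π hπ) ρ) :
    IsGeometricOpticsMeasure h Γ I Ω ρ (targetMeasure Ω π hπ) := by
  have henergy (w : Set (EuclideanSpace ℝ (Fin n))) (hw : MeasurableSet w) :
      (targetMeasure Ω π hπ : Measure (EuclideanSpace ℝ (Fin n))) w =
        deliveredEnergy h Γ I ρ (w ∩ Ω) := by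
    rw [hρ.2 _ (hw.inter hΩ) Set.inter_subset_right, targetMeasure_inter hΩ]
  have hnull := sourceMeasure_compl hΓ I
  have : IsFiniteMeasure (sourceMeasure Γ I) := isFiniteMeasure_withDensity_ofReal hI.2
  refine ⟨henergy, fun T hT => aemeasurable_and_map_eq_of_measure_preimage_le ?_ fun w hw => ?_⟩
  -- Total masses agree because every direction of `Γ` sees a focus in `Ω` and `Γᶜ` is null.
  · rw [henergy _ MeasurableSet.univ, Set.univ_inter, deliveredEnergy_eq, hρ.1.visibilitySet_eq,
      ← measure_inter_conull (s := Set.univ) (t := Γ) hnull,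
      Set.univ_inter]
  -- `T` is unconstrained off `Γ`, so the preimage is first cut down to `Γ`.
  · rw [henergy w hw, deliveredEnergy_eq,
      ← measure_inter_conull (t := Γ) hnull]
    refine measure_mono fun x hx => ?_
    obtain ⟨hxΩ, hd⟩ := hT x hx.2
    exact ⟨T x, ⟨hx.1, hxΩ⟩, hd⟩

theorem theorem3p4 {n : ℕ} (hn : 1 ≤ n) (h : ℝ) (hh : h < 0)
    (Γ : Set (Directions n)) (hΓ : MeasurableSet Γ)
    (I : Directions n → ℝ) (hI : IntegrableOn I Γ (surfaceMeasure n))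
    (hI0 : ∀ᵐ x ∂(surfaceMeasure n).restrict Γ, 0 ≤ I x)
    (Ω : Set (EuclideanSpace ℝ (Fin n))) (hΩ : IsBoundedSmoothDomain Ω)
    (Ωk : ℕ → Set (EuclideanSpace ℝ (Fin n))) (hΩk : ∀ k, IsBoundedSmoothDomain (Ωk k))
    (π : EuclideanSpace ℝ (Fin n) → ℝ)
    (hπ : IntegrableOn π Ω volume) (hπk : ∀ k, IntegrableOn π (Ωk k) volume)
    (hπ0 : ∀ᵐ z ∂volume.restrict Ω, 0 ≤ π z)
    (hπ0k : ∀ k, ∀ᵐ z ∂volume.restrict (Ωk k), 0 ≤ π z)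
    (energy : ∫ x in Γ, I x ∂(surfaceMeasure n) = ∫ z in Ω, π z)
    (ρ : Directions n → ℝ) (hρ : IsWeakSolution h Γ I Ω (targetMeasure Ω π hπ) ρ)
    (ρk : ℕ → Directions n → ℝ)
    (hρk : ∀ k, IsWeakSolution h Γ I (Ωk k) (targetMeasure (Ωk k) π (hπk k)) (ρk k)) :
    ∃ (μR : FiniteMeasure (EuclideanSpace ℝ (Fin n)))
      (μRk : ℕ → FiniteMeasure (EuclideanSpace ℝ (Fin n))),
      IsGeometricOpticsMeasure h Γ I Ω ρ μR ∧
      (∀ k, IsGeometricOpticsMeasure h Γ I (Ωk k) (ρk k) (μRk k)) ∧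
      (Tendsto (fun k => targetMeasure (Ωk k) π (hπk k)) atTop (𝓝 (targetMeasure Ω π hπ)) →
        Tendsto μRk atTop (𝓝 μR)) ∧
      (∀ w : Set (EuclideanSpace ℝ (Fin n)), MeasurableSet w →
        Tendsto (fun k => targetMeasure (Ωk k) π (hπk k) w) atTop
          (𝓝 (targetMeasure Ω π hπ w)) →
        Tendsto (fun k => μRk k w) atTop (𝓝 (μR w))) := by
  exact ⟨targetMeasure Ω π hπ, fun k => targetMeasure (Ωk k) π (hπk k),
    hρ.isGeometricOpticsMeasure hΓ hI hΩ.isOpen.measurableSet,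
    fun k => (hρk k).isGeometricOpticsMeasure hΓ hI (hΩk k).isOpen.measurableSet,
    id, fun _ _ => id⟩
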